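/- Let $\mathscr A_1,\mathscr A_2$ be unital C$^*$-algebras, $\mathcal H$ a complex Hilbert space, and $\mathscr A_0=\mathsf B(\mathcal H)$. For completely positive (CP) maps $S,R$ between the same C$^*$-algebras write $S\le R$ if $R-S$ is completely positive. Let $R^{(i)}:\mathscr A_i\to\mathscr A_{i-1}$ ($i=1,2$) be unital CP maps. Then there exist a Hilbert space $\mathcal K$, a unital $*$-representation $\pi:\mathscr A_2\to\mathsf B(\mathcal K)$ and an isometry $V:\mathcal H\to\mathcal K$ (depending only on $R^{(1)},R^{(2)}$) with the following two properties. (1) Let $(S^{(i)}_{x_i})_{x_i\in I_i}$, $i=1,2$, be families of CP maps $\mathscr A_i\to\mathscr A_{i-1}$, indexed by arbitrary sets $I_i$, with $S^{(i)}_{x_i}\le R^{(i)}$ for all $x_i$. Then there are self-adjoint operators $F^{(1)}_{x_1},F^{(2)}_{x_2}\in\mathsf B(\mathcal K)$ ($x_1\in I_1$, $x_2\in I_2$) with $0\le F^{(i)}_{x_i}\le \mathbb 1_{\mathcal K}$ such that, for all $x_1,x_2$ and all $a\in\mathscr A_2$, $$S^{(1)}_{x_1}\circ S^{(2)}_{x_2}(a)=V^*F^{(1)}_{x_1}F^{(2)}_{x_2}\,\pi(a)\,V,\qquad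 [F^{(1)}_{x_1},F^{(2)}_{x_2}]=[F^{(1)}_{x_1},\pi(a)]=[F^{(2)}_{x_2},\pi(a)]=0 .$$ Moreover, for $i=1,2$, whenever a finite set $J\subseteq I_i$ satisfies $\sum_{x\in J}S^{(i)}_x=R^{(i)}$, the operators $(F^{(i)}_x)_{x\in J}$ form a POVM: they are positive and $\sum_{x\in J}F^{(i)}_x=\mathbb 1_{\mathcal K}$. (2) In particular, let $R^{(i)}=\sum_{k_i}R^{(i)}_{k_i}$ ($i=1,2$) be finite decompositions into CP maps $R^{(i)}_{k_i}:\mathscr A_i\to\mathscr A_{i-1}$. Then there are self-adjoint operators $F^{(i)}_{k_i}\in\mathsf B(\mathcal K)$ with $0\le F^{(i)}_{k_i}\le\mathbb 1_{\mathcal K}$ and $\sum_{k_i}F^{(i)}_{k_i}=\mathbb 1_{\mathcal K}$ for $i=1,2$ (so that they form POVMs) such that, for all $k_1,k_2$ and all $a\in\mathscr A_2$, $$R^{(1)}_{k_1}\circ R^{(2)}_{k_2}(a)=V^*F^{(1)}_{k_1}F^{(2)}_{k_2}\,\pi(a)\,V,\qquad [F^{(1)}_{k_1},F^{(2)}_{k_2}]=[F^{(1)}_{k_1},\pi(a)]=[F^{(2)}_{k_2},\pi(a)]=0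 .$$ -/

import Mathlib

open scoped CStarAlgebra

universe u v₁ v₂ w₁ w₂

/-- The order on completely positive maps: `S ≤ R` means that `R - S` is completely positive. -/
def CPDominated {A B : Type*} [CStarAlgebra A] [PartialOrder A] [StarOrderedRing A]
    [CStarAlgebra B] [PartialOrder B] [StarOrderedRing B] (S R : A →CP B) : Prop :=
  ∃ D : A →CP B, D.toLinearMap = R.toLinearMap - S.toLinearMap

/-- A positive operator-valued measure with a finite set `κ` of outcomes on the Hilbert
space `K`. -/
structure IsFinitePOVM {κ K : Type*} [Fintype κ] [NormedAddCommGroup K] [InnerProductSpace ℂ K]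
    [CompleteSpace K] (F : κ → (K →L[ℂ] K)) : Prop where
  nonneg : ∀ k, 0 ≤ F k
  sum_eq_one : ∑ k, F k = 1

/-- For families of completely positive maps `S₁ x₁ : A₁ → B(H)` and `S₂ x₂ : A₂ → A₁`, the
operators `F₁ x₁`, `F₂ x₂` on `K` lie between `0` and `1`, commute with each other and with
`π(A₂)`, and satisfy `S₁ x₁ (S₂ x₂ a) = V* F₁ x₁ F₂ x₂ π(a) V`. -/
structure IsChainDerivative {A₁ A₂ H K ι₁ ι₂ : Type*}
    [CStarAlgebra A₁] [PartialOrder A₁] [StarOrderedRing A₁]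
    [CStarAlgebra A₂] [PartialOrder A₂] [StarOrderedRing A₂]
    [NormedAddCommGroup H] [InnerProductSpace ℂ H] [CompleteSpace H]
    [NormedAddCommGroup K] [InnerProductSpace ℂ K] [CompleteSpace K]
    (S₁ : ι₁ → (A₁ →CP (H →L[ℂ] H))) (S₂ : ι₂ → (A₂ →CP A₁))
    (π : A₂ →⋆ₐ[ℂ] (K →L[ℂ] K)) (V : H →ₗᵢ[ℂ] K)
    (F₁ : ι₁ → (K →L[ℂ] K)) (F₂ : ι₂ → (K →L[ℂ] K)) : Prop where
  isSelfAdjoint₁ : ∀ x₁, IsSelfAdjoint (F₁ x₁)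
  isSelfAdjoint₂ : ∀ x₂, IsSelfAdjoint (F₂ x₂)
  nonneg₁ : ∀ x₁, 0 ≤ F₁ x₁
  nonneg₂ : ∀ x₂, 0 ≤ F₂ x₂
  le_one₁ : ∀ x₁, F₁ x₁ ≤ 1
  le_one₂ : ∀ x₂, F₂ x₂ ≤ 1
  commute : ∀ x₁ x₂, Commute (F₁ x₁) (F₂ x₂)
  commute_rep₁ : ∀ x₁ a, Commute (F₁ x₁) (π a)
  commute_rep₂ : ∀ x₂ a, Commute (F₂ x₂) (π a)
  comp_eq : ∀ x₁ x₂ a, S₁ x₁ (S₂ x₂ a) =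
    ContinuousLinearMap.adjoint V.toContinuousLinearMap ∘L
      (F₁ x₁ * F₂ x₂ * π a) ∘L V.toContinuousLinearMap

/-!
The space `K` arises from two minimal Stinespring dilations, one on top of the other. Let
`R₁ a = V₁* ρ(a) V₁` be the minimal dilation of `R₁`, on a space `K₁`, and let
`ρ(R₂ a) = V₂* π(a) V₂` be the minimal dilation of `ρ ∘ R₂ : A₂ → B(K₁)`, on `K`. The isometry is
`V = V₂ V₁`. Stinespring's theorem (`CompletelyPositiveMap.exists_isMinimalDilation`) is proved by
taking the reproducing kernel Hilbert space of the positive semidefinite kernel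
`(a, b) ↦ φ(a* b)`, on which `A` acts by left multiplication of the labels.

By the Radon–Nikodym theorem for completely positive maps
(`IsMinimalDilation.exists_isRadonNikodym_of_isDilation`), a map dominated by `φ` is
`a ↦ V* F π(a) V` for an effect `F` in the commutant of `π(A)`, where `(π, V)` is the minimal
dilation of `φ`. Here `F = T* T`, with `T` the contraction from the dilation space of `φ` to that of
the dominated map. This gives `D x₁` on `K₁`, commuting with `ρ(A₁)`, for `S₁ x₁`, and `F₂ x₂` on
`K` for `ρ ∘ S₂ x₂`.

As `D x₁` commutes with `ρ(R₂ a)`, the map `a ↦ ρ(R₂ a) D x₁` is completely positive and dominated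
by `ρ ∘ R₂`; its derivative `F₁ x₁` satisfies `F₁ x₁ V₂ = V₂ D x₁`
(`IsMinimalDilation.exists_lift`). Hence
`V₂* F₁ x₁ F₂ x₂ π(a) V₂ = D x₁ ρ(S₂ x₂ a) = ρ(S₂ x₂ a) D x₁ = V₂* F₂ x₂ F₁ x₁ π(a) V₂`.
An operator in the commutant of `π(A)` is determined by such compressions
(`IsMinimalDilation.commutant_ext`), so `F₁ x₁` and `F₂ x₂` commute; compressing further by `V₁`
gives `S₁ x₁ (S₂ x₂ a)`. The same uniqueness shows that derivatives of maps summing to `φ` sum to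
the identity.
-/

open scoped InnerProductSpace
open ContinuousLinearMap

/-! ### Operators defined on a total family of vectors -/

section TotalFamily

variable {X H K K' K'' : Type*} [NormedAddCommGroup H] [InnerProductSpace ℂ H]
  [NormedAddCommGroup K] [InnerProductSpace ℂ K]
  [NormedAddCommGroup K'] [InnerProductSpace ℂ K']
  [NormedAddCommGroup K''] [InnerProductSpace ℂ K'']

/-- The ranges of the operators `e x` together span a dense subspace of `K`. -/
def IsTotalFamily (e : X → H →L[ℂ] K) : Prop :=
  Dense (Submodule.span ℂ {y | ∃ x h, e x h = y} : Set K)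

theorem IsTotalFamily.clm_ext {e : X → H →L[ℂ] K} (he : IsTotalFamily e) {S T : K →L[ℂ] K'}
    (h : ∀ x, S ∘L e x = T ∘L e x) : S = T := by
  refine ContinuousLinearMap.ext_on he ?_
  rintro _ ⟨x, k, rfl⟩
  exact DFunLike.congr_fun (h x) k

/-- The linear map sending a finitely supported family of vectors `v` to `∑ e x (v x)`. -/
noncomputable def familySum (e : X → H →L[ℂ] K) : (X →₀ H) →ₗ[ℂ] K :=
  Finsupp.lsum ℂ fun x => (e x : H →ₗ[ℂ] K)

theorem familySum_single (e : X → H →L[ℂ] K) (x : X) (h : H) :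
    familySum e (Finsupp.single x h) = e x h := by
  simp [familySum]

theorem inner_familySum (e : X → H →L[ℂ] K) (v w : X →₀ H) :
    ⟪familySum e v, familySum e w⟫_ℂ =
      v.sum fun x h => w.sum fun y k => ⟪e x h, e y k⟫_ℂ := by
  rw [Finsupp.sum_comm]
  simp [familySum, Finsupp.sum_inner, Finsupp.inner_sum]

theorem IsTotalFamily.denseRange_familySum {e : X → H →L[ℂ] K} (he : IsTotalFamily e) :
    DenseRange (familySum e) := by
  refine he.mono ?_
  rw [← LinearMap.coe_range, SetLike.coe_subset_coe, Submodule.span_le]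
  rintro _ ⟨x, h, rfl⟩
  exact ⟨Finsupp.single x h, familySum_single e x h⟩

/-- If the Gram kernel of `f` is at most `C ^ 2` times that of the total family `e`, the
difference being the Gram kernel of a third family `g`, then `e x h ↦ f x h` extends to a bounded
operator of norm at most `C`. -/
theorem IsTotalFamily.exists_clm [CompleteSpace K'] {e : X → H →L[ℂ] K} (he : IsTotalFamily e)
    (f : X → H →L[ℂ] K') (g : X → H →L[ℂ] K'') {C : ℝ} (hC : 0 ≤ C)
    (hfg : ∀ x y h k, ⟪f x h, f y k⟫_ℂ + ⟪g x h, g y k⟫_ℂ = (C : ℂ) ^ 2 * ⟪e x h, e y k⟫_ℂ) :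
    ∃ T : K →L[ℂ] K', ‖T‖ ≤ C ∧ ∀ x, T ∘L e x = f x := by
  have hsq (v : X →₀ H) :
      ‖familySum f v‖ ^ 2 + ‖familySum g v‖ ^ 2 = C ^ 2 * ‖familySum e v‖ ^ 2 := by
    have : ⟪familySum f v, familySum f v⟫_ℂ + ⟪familySum g v, familySum g v⟫_ℂ
        = (C : ℂ) ^ 2 * ⟪familySum e v, familySum e v⟫_ℂ := by
      simp only [inner_familySum, ← Finsupp.sum_add, hfg]
      simp only [Finsupp.sum, Finset.mul_sum]
    simp only [inner_self_eq_norm_sq_to_K, RCLike.ofReal_eq_complex_ofReal] at this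
    exact_mod_cast this
  have hle (v : X →₀ H) : ‖familySum f v‖ ≤ C * ‖familySum e v‖ := by
    rw [← sq_le_sq₀ (by positivity) (by positivity), mul_pow, ← hsq v]
    exact le_add_of_nonneg_right (by positivity)
  refine ⟨(familySum f).extendOfNorm (familySum e),
    LinearMap.opNorm_extendOfNorm_le he.denseRange_familySum hC hle, fun x => ?_⟩
  ext h
  simpa [familySum_single] using
    LinearMap.extendOfNorm_eq he.denseRange_familySum ⟨C, hle⟩ (Finsupp.single x h)

end TotalFamily

/-! ### Stinespring dilations -/

section Stinespring

variable {A B H K K' K'' : Type*} [CStarAlgebra A]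
  [NormedAddCommGroup H] [InnerProductSpace ℂ H] [CompleteSpace H]
  [NormedAddCommGroup K] [InnerProductSpace ℂ K] [CompleteSpace K]
  [NormedAddCommGroup K'] [InnerProductSpace ℂ K'] [CompleteSpace K']
  [NormedAddCommGroup K''] [InnerProductSpace ℂ K''] [CompleteSpace K'']

/-- `(π, V)` is a Stinespring dilation of `φ`, that is, `φ a = V* π(a) V`. Minimality is not part
of the notion. -/
def IsDilation (φ : A → H →L[ℂ] H) (π : A →⋆ₐ[ℂ] (K →L[ℂ] K)) (V : H →L[ℂ] K) : Prop :=
  ∀ a, φ a = adjoint V ∘L π a ∘L V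

/-- A Stinespring dilation is minimal when `π(A) V H` spans a dense subspace. -/
structure IsMinimalDilation (φ : A → H →L[ℂ] H) (π : A →⋆ₐ[ℂ] (K →L[ℂ] K))
    (V : H →L[ℂ] K) : Prop where
  isDilation : IsDilation φ π V
  total : IsTotalFamily fun a => π a ∘L V

theorem IsDilation.inner_eq {φ : A → H →L[ℂ] H} {π : A →⋆ₐ[ℂ] (K →L[ℂ] K)} {V : H →L[ℂ] K}
    (hφ : IsDilation φ π V) (a b : A) (h k : H) :
    ⟪π a (V h), π b (V k)⟫_ℂ = ⟪h, φ (star a * b) k⟫_ℂ := by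
  rw [hφ, map_mul, map_star]
  simp [star_eq_adjoint, adjoint_inner_right]

/-- Stated for an abstract algebra so that it applies to `CStarMatrix`, for which the functional
calculus required by `CStarAlgebra.nonneg_iff_eq_star_mul_self` is not found by instance search. -/
theorem NonUnitalCStarAlgebra.exists_eq_star_mul_self {C : Type*} [NonUnitalCStarAlgebra C]
    [PartialOrder C] [StarOrderedRing C] {x : C} (hx : 0 ≤ x) : ∃ y, x = star y * y :=
  CStarAlgebra.nonneg_iff_eq_star_mul_self.mp hx

/-- The kernel `(a, b) ↦ φ(a* b)` of a completely positive map is positive semidefinite. -/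
theorem CompletelyPositiveMap.posSemidef_kernel [PartialOrder A] [StarOrderedRing A]
    [CStarAlgebra B] [PartialOrder B] [StarOrderedRing B] (φ : A →CP B) :
    (Matrix.of fun a b : A => φ (star a * b)).PosSemidef := by
  classical
  have key (s : Finset A) : ∃ N : s → A → B, ∀ a ∈ s, ∀ b ∈ s,
      φ (star a * b) = ∑ c, star (N c a) * N c b := by
    rcases s.eq_empty_or_nonempty with rfl | ⟨c, hc⟩
    · exact ⟨0, fun a ha => absurd ha (Finset.notMem_empty _)⟩
    -- The matrix `(a* b)` is `M* M` for the matrix `M` whose only nonzero row is `(a)`.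
    let M : CStarMatrix s s A := CStarMatrix.ofMatrix fun i j => if i = ⟨c, hc⟩ then (j : A) else 0
    obtain ⟨N, hN⟩ := NonUnitalCStarAlgebra.exists_eq_star_mul_self
      (φ.map_cstarMatrix_nonneg (star M * M) (star_mul_self_nonneg M))
    refine ⟨fun c a => if h : a ∈ s then N c ⟨a, h⟩ else 0, fun a ha b hb => ?_⟩
    have := congr_fun (congr_fun hN ⟨a, ha⟩) ⟨b, hb⟩
    have hM (i j : s) : M i j = if i = ⟨c, hc⟩ then (j : A) else 0 := rfl
    simpa [CStarMatrix.map_apply, CStarMatrix.mul_apply, CStarMatrix.star_apply, hM, ha, hb,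
      apply_ite star, ite_mul, -map_sum] using this
  refine ⟨?_, fun x => ?_⟩
  · ext a b
    obtain ⟨N, hN⟩ := key {a, b}
    simp [hN a (by simp) b (by simp), hN b (by simp) a (by simp)]
  · obtain ⟨N, hN⟩ := key x.support
    have : (x.sum fun a xa => x.sum fun b xb => star xa * φ (star a * b) * xb) =
        ∑ c, star (∑ a ∈ x.support, N c a * x a) * ∑ b ∈ x.support, N c b * x b := by
      simp only [Finsupp.sum, star_sum, Finset.sum_mul_sum]
      symm
      rw [Finset.sum_comm]
      refine Finset.sum_congr rfl fun a ha => ?_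
      rw [Finset.sum_comm]
      refine Finset.sum_congr rfl fun b hb => ?_
      simp only [hN a ha b hb, Finset.mul_sum, Finset.sum_mul, star_mul, mul_assoc]
    simp only [Matrix.of_apply]
    rw [this]
    exact Finset.sum_nonneg fun c _ => star_mul_self_nonneg _

/-- **Stinespring's theorem**: a completely positive map into `B(H)` has a minimal dilation. -/
theorem CompletelyPositiveMap.exists_isMinimalDilation {A : Type v₁} {H : Type u} [CStarAlgebra A]
    [PartialOrder A] [StarOrderedRing A]
    [NormedAddCommGroup H] [InnerProductSpace ℂ H] [CompleteSpace H] (φ : A →CP (H →L[ℂ] H)) :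
    ∃ (K : Type (max u v₁)) (_ : NormedAddCommGroup K) (_ : InnerProductSpace ℂ K)
      (_ : CompleteSpace K) (π : A →⋆ₐ[ℂ] (K →L[ℂ] K)) (V : H →L[ℂ] K),
      IsMinimalDilation φ π V := by
  let Φ : Matrix A A (H →L[ℂ] H) := Matrix.of fun a b => φ (star a * b)
  have : Fact Φ.PosSemidef := ⟨φ.posSemidef_kernel⟩
  let K := RKHS.OfKernel Φ
  let e : A → H →L[ℂ] K := RKHS.kerFun K
  have he : IsTotalFamily e := by
    rw [IsTotalFamily, Submodule.dense_iff_topologicalClosure_eq_top]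
    exact RKHS.kerFun_dense K
  have inner_e (a b : A) (h k : H) : ⟪e a h, e b k⟫_ℂ = ⟪h, φ (star a * b) k⟫_ℂ := by
    rw [RKHS.kerFun_inner, RKHS.kerFun_apply, RKHS.OfKernel.kernel_ofKernel]
    rfl
  have ext_e {x y : K} (hxy : ∀ a h, ⟪e a h, x⟫_ℂ = ⟪e a h, y⟫_ℂ) : x = y := by
    have := he.clm_ext (S := innerSL ℂ x) (T := innerSL ℂ y) fun a => by
      ext h
      rw [comp_apply, comp_apply, innerSL_apply_apply, innerSL_apply_apply,
        ← inner_conj_symm, hxy, inner_conj_symm]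
    exact ext_inner_right ℂ fun z => DFunLike.congr_fun this z
  -- Left multiplication by `c` on the labels is bounded by `‖c‖`: its defect is left
  -- multiplication by a square root of `‖c‖² - c* c`.
  have hL (c : A) : ∃ T : K →L[ℂ] K, ‖T‖ ≤ ‖c‖ ∧ ∀ a, T ∘L e a = e (c * a) := by
    obtain ⟨d, hd⟩ := CStarAlgebra.nonneg_iff_eq_star_mul_self.mp
      (sub_nonneg.mpr (CStarAlgebra.star_mul_le_algebraMap_norm_sq (a := c)))
    refine he.exists_clm (fun a => e (c * a)) (fun a => e (d * a)) (norm_nonneg c) ?_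
    intro a b h k
    have hcd : star (c * a) * (c * b) + star (d * a) * (d * b) =
        ((‖c‖ : ℂ) ^ 2) • (star a * b) := by
      have : star (c * a) * (c * b) + star (d * a) * (d * b)
          = star a * (star c * c + star d * d) * b := by
        simp only [star_mul]; noncomm_ring
      rw [this, ← hd, add_sub_cancel, ← Complex.ofReal_pow, Complex.coe_smul,
        Algebra.algebraMap_eq_smul_one]
      simp
    simp only [inner_e]
    rw [← inner_add_right, ← add_apply, ← map_add, hcd, map_smul, smul_apply, inner_smul_right]
  choose L _ hL using hL
  have hLe (c a : A) (h : H) : L c (e a h) = e (c * a) h := DFunLike.congr_fun (hL c a) h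
  have e_add (a b : A) : e (a + b) = e a + e b := by
    refine ContinuousLinearMap.ext fun h => ext_e fun c k => ?_
    rw [add_apply, inner_add_right]
    simp [inner_e, mul_add]
  have e_smul (r : ℂ) (a : A) : e (r • a) = r • e a := by
    refine ContinuousLinearMap.ext fun h => ext_e fun c k => ?_
    simp [inner_e, inner_smul_right]
  let π : A →⋆ₐ[ℂ] (K →L[ℂ] K) := StarAlgHom.mk (AlgHom.ofLinearMap
    { toFun := L
      map_add' := fun a b => he.clm_ext fun c => by
        ext h
        simp [hLe, add_mul, e_add]
      map_smul' := fun r a => he.clm_ext fun c => by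
        ext h
        simp [hLe, e_smul] }
    (he.clm_ext fun c => by
      ext h
      simp [hLe])
    (fun a b => he.clm_ext fun c => by
      ext h
      simp [hLe, mul_assoc])) (fun a => he.clm_ext fun c => by
      refine ContinuousLinearMap.ext fun h => ext_e fun b k => ?_
      simp [hLe, star_eq_adjoint, adjoint_inner_right, inner_e, mul_assoc])
  have hπ (c a : A) : π c ∘L e a = e (c * a) := hL c a
  refine ⟨K, inferInstance, inferInstance, inferInstance, π, e 1, fun a => ?_, ?_⟩
  · ext h
    refine ext_inner_left ℂ fun k => ?_
    rw [hπ]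
    simp [adjoint_inner_right, inner_e]
  · simpa [hπ] using he

/-- Two operators in the commutant of a minimal dilation agree if they compress to the same map. -/
theorem IsMinimalDilation.commutant_ext {φ : A → H →L[ℂ] H} {π : A →⋆ₐ[ℂ] (K →L[ℂ] K)}
    {V : H →L[ℂ] K} (hφ : IsMinimalDilation φ π V) {S T : K →L[ℂ] K}
    (hS : ∀ a, Commute S (π a)) (hT : ∀ a, Commute T (π a))
    (h : ∀ a, adjoint V ∘L (S * π a) ∘L V = adjoint V ∘L (T * π a) ∘L V) : S = T := by
  refine hφ.total.clm_ext fun a => ?_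
  suffices adjoint (S ∘L π a ∘L V) = adjoint (T ∘L π a ∘L V) from adjoint.injective this
  -- `V* π(a)* S* π(b) V` is the adjoint of `V* S π(b* a) V`.
  have key {X : K →L[ℂ] K} (hX : ∀ a, Commute X (π a)) (b : A) :
      adjoint (X ∘L π a ∘L V) ∘L (π b ∘L V) =
        adjoint (adjoint V ∘L (X * π (star b * a)) ∘L V) := by
    rw [map_mul, ← mul_assoc, (hX _).eq]
    simp only [mul_def, adjoint_comp, adjoint_adjoint, map_star, star_eq_adjoint, comp_assoc]
  exact hφ.total.clm_ext fun b => by rw [key hS, key hT, h]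

/-- `F` is the Radon–Nikodym derivative of `ψ` with respect to the dilation `(π, V)`: an effect in
the commutant of `π(A)` with `ψ a = V* F π(a) V`. -/
structure IsRadonNikodym (ψ : A → H →L[ℂ] H) (π : A →⋆ₐ[ℂ] (K →L[ℂ] K)) (V : H →L[ℂ] K)
    (F : K →L[ℂ] K) : Prop where
  nonneg : 0 ≤ F
  le_one : F ≤ 1
  commute : ∀ a, Commute F (π a)
  eq : ∀ a, adjoint V ∘L (F * π a) ∘L V = ψ a

/-- **Radon–Nikodym theorem for completely positive maps**: if `φ` has a minimal dilation and both
`ψ` and `φ - ψ` have dilations, then `ψ` has a derivative. It is `T* T` for the contraction `T`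
sending `π(a) V h` to `π' a (V' h)`. -/
theorem IsMinimalDilation.exists_isRadonNikodym_of_isDilation {φ ψ : A → H →L[ℂ] H}
    {π : A →⋆ₐ[ℂ] (K →L[ℂ] K)} {V : H →L[ℂ] K} (hφ : IsMinimalDilation φ π V)
    {π' : A →⋆ₐ[ℂ] (K' →L[ℂ] K')} {V' : H →L[ℂ] K'} (hψ : IsDilation ψ π' V')
    {π'' : A →⋆ₐ[ℂ] (K'' →L[ℂ] K'')} {V'' : H →L[ℂ] K''} (hφψ : IsDilation (φ - ψ) π'' V'') :
    ∃ F, IsRadonNikodym ψ π V F := by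
  obtain ⟨T, hT, hTe⟩ := hφ.total.exists_clm (fun a => π' a ∘L V') (fun a => π'' a ∘L V'')
    zero_le_one fun a b h k => by
      simp [hφ.isDilation.inner_eq, hψ.inner_eq, hφψ.inner_eq]
  have hcomm (a : A) : T ∘L π a = π' a ∘L T := hφ.total.clm_ext fun b => by
    have := hTe (a * b)
    simp only [map_mul] at this
    rw [comp_assoc, comp_assoc, hTe]
    exact this
  have hcomm' (a : A) : adjoint T ∘L π' a = π a ∘L adjoint T := by
    have := congrArg adjoint (hcomm (star a))
    simpa [adjoint_comp, ← star_eq_adjoint, ← map_star] using this.symm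
  have hTV : T ∘L V = V' := by
    ext h
    simpa using DFunLike.congr_fun (hTe 1) h
  refine ⟨adjoint T ∘L T, ⟨?_, ?_, fun a => ?_, fun a => ?_⟩⟩
  · exact (nonneg_iff_isPositive _).mpr (isPositive_adjoint_comp_self T)
  · rw [← CStarAlgebra.norm_le_one_iff_of_nonneg _
      ((nonneg_iff_isPositive _).mpr (isPositive_adjoint_comp_self T)), norm_adjoint_comp_self]
    exact mul_le_one₀ hT (norm_nonneg T) hT
  · change (adjoint T ∘L T) ∘L π a = π a ∘L (adjoint T ∘L T)
    rw [comp_assoc, hcomm, ← comp_assoc, hcomm', comp_assoc]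
  · rw [hψ a, ← hTV, adjoint_comp]
    change adjoint V ∘L ((adjoint T ∘L T) ∘L π a) ∘L V = _
    rw [comp_assoc (adjoint T), hcomm]
    rfl

end Stinespring

/-! ### Operations on completely positive maps -/

section CompletelyPositive

variable {A B C : Type*} [CStarAlgebra A] [PartialOrder A] [StarOrderedRing A]
  [CStarAlgebra B] [PartialOrder B] [StarOrderedRing B]
  [CStarAlgebra C] [PartialOrder C] [StarOrderedRing C]

/-- The completely positive map `ρ ∘ φ`, for `φ` completely positive and `ρ` a `*`-homomorphism. -/
noncomputable def StarAlgHom.compCP (ρ : B →⋆ₐ[ℂ] C) (φ : A →CP B) : A →CP C where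
  toLinearMap := (ρ : B →ₗ[ℂ] C) ∘ₗ φ.toLinearMap
  map_cstarMatrix_nonneg' k M hM :=
    CompletelyPositiveMapClass.map_cstarMatrix_nonneg' ρ k _
      (φ.map_cstarMatrix_nonneg' k M hM)

@[simp]
theorem StarAlgHom.compCP_apply (ρ : B →⋆ₐ[ℂ] C) (φ : A →CP B) (a : A) :
    ρ.compCP φ a = ρ (φ a) := rfl

/-- A finite sum of completely positive maps is completely positive. -/
noncomputable def CompletelyPositiveMap.finsetSum {ι : Type*} (s : Finset ι) (φ : ι → A →CP B) :
    A →CP B where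
  toLinearMap := ∑ i ∈ s, (φ i).toLinearMap
  map_cstarMatrix_nonneg' k M hM := by
    have : M.map ⇑(∑ i ∈ s, (φ i).toLinearMap) = ∑ i ∈ s, M.map (φ i) := by
      classical
      induction s using Finset.induction_on with
      | empty => ext i j; simp
      | insert i s hi ih =>
        rw [Finset.sum_insert hi, Finset.sum_insert hi, ← ih]
        rfl
    rw [this]
    exact Finset.sum_nonneg fun i _ => (φ i).map_cstarMatrix_nonneg M hM

theorem CPDominated.of_sum_eq {κ : Type*} [Fintype κ] {Q : κ → A →CP B} {R : A →CP B}
    (h : ∀ a, ∑ k, Q k a = R a) (k : κ) : CPDominated (Q k) R := by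
  classical
  refine ⟨CompletelyPositiveMap.finsetSum (Finset.univ.erase k) Q, ?_⟩
  ext a
  change (∑ i ∈ Finset.univ.erase k, (Q i).toLinearMap) a = R a - Q k a
  rw [← h a, ← Finset.sum_erase_add _ _ (Finset.mem_univ k), add_sub_cancel_right,
    LinearMap.sum_apply]
  rfl

theorem CPDominated.compCP {S R : A →CP B} (h : CPDominated S R) (ρ : B →⋆ₐ[ℂ] C) :
    CPDominated (ρ.compCP S) (ρ.compCP R) := by
  obtain ⟨D, hD⟩ := h
  refine ⟨ρ.compCP D, ?_⟩
  ext a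
  have : D a = R a - S a := DFunLike.congr_fun hD a
  change ρ (D a) = ρ (R a) - ρ (S a)
  rw [this, map_sub]

end CompletelyPositive

/-! ### Derivatives with respect to a minimal dilation -/

section Derivative

variable {A H K : Type*} [CStarAlgebra A]
  [NormedAddCommGroup H] [InnerProductSpace ℂ H] [CompleteSpace H]
  [NormedAddCommGroup K] [InnerProductSpace ℂ K] [CompleteSpace K]

theorem IsMinimalDilation.exists_isRadonNikodym [PartialOrder A] [StarOrderedRing A]
    {R S : A →CP (H →L[ℂ] H)} {π : A →⋆ₐ[ℂ] (K →L[ℂ] K)} {V : H →L[ℂ] K}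
    (hR : IsMinimalDilation R π V) (hS : CPDominated S R) : ∃ F, IsRadonNikodym S π V F := by
  obtain ⟨D, hD⟩ := hS
  obtain ⟨K', _, _, _, π', V', h'⟩ := S.exists_isMinimalDilation
  obtain ⟨K'', _, _, _, π'', V'', h''⟩ := D.exists_isMinimalDilation
  have hRS : IsDilation (⇑R - ⇑S) π'' V'' := fun a => by
    rw [← h''.isDilation a]
    exact (DFunLike.congr_fun hD a).symm
  exact hR.exists_isRadonNikodym_of_isDilation h'.isDilation hRS

/-- For `T ≥ 0` commuting with `φ(A)`, the map `a ↦ φ(a) T = √T φ(a) √T` is dilated by the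
representation that dilates `φ`. -/
theorem IsDilation.mul_right {φ : A → H →L[ℂ] H} {π : A →⋆ₐ[ℂ] (K →L[ℂ] K)} {V : H →L[ℂ] K}
    (hφ : IsDilation φ π V) {T : H →L[ℂ] H} (hT : 0 ≤ T) (hc : ∀ a, Commute T (φ a)) :
    IsDilation (fun a => φ a * T) π (V ∘L CFC.sqrt T) := fun a => by
  have hs : Commute (CFC.sqrt T) (φ a) := by
    rw [CFC.sqrt_eq_cfc]
    exact (hc a).cfc_nnreal _
  have hsa : adjoint (CFC.sqrt T) = CFC.sqrt T :=
    (IsSelfAdjoint.of_nonneg (CFC.sqrt_nonneg T)).star_eq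
  calc φ a * T = φ a * (CFC.sqrt T * CFC.sqrt T) := by rw [CFC.sqrt_mul_sqrt_self T]
    _ = CFC.sqrt T * φ a * CFC.sqrt T := by rw [← mul_assoc, hs.eq]
    _ = _ := by rw [hφ a, adjoint_comp, hsa]; rfl

/-- An effect `T` commuting with `φ(A)` lifts to an effect `F` commuting with `π(A)`: the
derivative of the completely positive map `a ↦ φ(a) T`, which intertwines `V`. -/
theorem IsMinimalDilation.exists_lift {φ : A → H →L[ℂ] H} {π : A →⋆ₐ[ℂ] (K →L[ℂ] K)}
    {V : H →L[ℂ] K} (hφ : IsMinimalDilation φ π V) {T : H →L[ℂ] H} (hT : 0 ≤ T) (hT' : T ≤ 1)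
    (hc : ∀ a, Commute T (φ a)) :
    ∃ F, IsRadonNikodym (fun a => φ a * T) π V F ∧ F ∘L V = V ∘L T := by
  have hsub : IsDilation (φ - fun a => φ a * T) π (V ∘L CFC.sqrt (1 - T)) := by
    convert hφ.isDilation.mul_right (sub_nonneg.mpr hT')
      fun a => (Commute.one_left _).sub_left (hc a) using 2 with a
    simp [mul_sub]
  obtain ⟨F, hF'⟩ :=
    hφ.exists_isRadonNikodym_of_isDilation (hφ.isDilation.mul_right hT hc) hsub
  refine ⟨F, hF', ?_⟩
  refine adjoint.injective (hφ.total.clm_ext fun b => ?_)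
  have hF : adjoint F = F := (IsSelfAdjoint.of_nonneg hF'.nonneg).star_eq
  have hTadj : adjoint T = T := (IsSelfAdjoint.of_nonneg hT).star_eq
  have e₁ : adjoint (F ∘L V) ∘L (π b ∘L V) = φ b * T := by
    rw [adjoint_comp, hF, ← hF'.eq b]
    rfl
  have e₂ : adjoint (V ∘L T) ∘L (π b ∘L V) = T * φ b := by
    rw [adjoint_comp, hTadj, hφ.isDilation b]
    rfl
  rw [e₁, e₂, (hc b).eq]

theorem IsRadonNikodym.mul_lift {ψ : A → H →L[ℂ] H} {π : A →⋆ₐ[ℂ] (K →L[ℂ] K)}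
    {V : H →L[ℂ] K} {F G : K →L[ℂ] K} {T : H →L[ℂ] H} (hF : IsRadonNikodym ψ π V F)
    (hc : ∀ a, Commute G (π a)) (hG : G ∘L V = V ∘L T) (a : A) :
    adjoint V ∘L (F * G * π a) ∘L V = ψ a * T := by
  rw [← hF.eq a, mul_assoc, (hc a).eq]
  simp only [mul_def, comp_assoc, hG]

theorem IsRadonNikodym.lift_mul {ψ : A → H →L[ℂ] H} {π : A →⋆ₐ[ℂ] (K →L[ℂ] K)}
    {V : H →L[ℂ] K} {F G : K →L[ℂ] K} {T : H →L[ℂ] H} (hF : IsRadonNikodym ψ π V F)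
    (hG₀ : 0 ≤ G) (hT₀ : 0 ≤ T) (hG : G ∘L V = V ∘L T) (a : A) :
    adjoint V ∘L (G * F * π a) ∘L V = T * ψ a := by
  have h := congrArg adjoint hG
  rw [adjoint_comp, adjoint_comp, show adjoint G = G from (IsSelfAdjoint.of_nonneg hG₀).star_eq,
    show adjoint T = T from (IsSelfAdjoint.of_nonneg hT₀).star_eq] at h
  rw [← hF.eq a, mul_assoc]
  simp only [mul_def, ← comp_assoc, h]

/-- If the maps `ψ i` sum to `φ`, then their derivatives sum to the identity. -/
theorem IsMinimalDilation.sum_eq_one {ι : Type*} {φ : A → H →L[ℂ] H} {π : A →⋆ₐ[ℂ] (K →L[ℂ] K)}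
    {V : H →L[ℂ] K} (hφ : IsMinimalDilation φ π V) {s : Finset ι} {ψ : ι → A → H →L[ℂ] H}
    {F : ι → K →L[ℂ] K} (hF : ∀ i, IsRadonNikodym (ψ i) π V (F i))
    (h : ∀ a, ∑ i ∈ s, ψ i a = φ a) : ∑ i ∈ s, F i = 1 := by
  refine hφ.commutant_ext (fun a => Commute.sum_left _ _ _ fun i _ => (hF i).commute a)
    (fun a => Commute.one_left _) fun a => ?_
  rw [one_mul, ← hφ.isDilation a, ← h a, Finset.sum_mul, finsetSum_comp, comp_finsetSum]
  exact Finset.sum_congr rfl fun i _ => (hF i).eq a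

theorem isFinitePOVM_subtype {ι : Type*} {F : ι → K →L[ℂ] K} {s : Finset ι} (h₀ : ∀ i, 0 ≤ F i)
    (h₁ : ∑ i ∈ s, F i = 1) : IsFinitePOVM fun i : s => F i where
  nonneg i := h₀ i
  sum_eq_one := by rw [← h₁, Finset.sum_coe_sort s F]

theorem IsFinitePOVM.of_univ {κ : Type*} [Fintype κ] {F : κ → K →L[ℂ] K}
    (h : IsFinitePOVM fun k : (Finset.univ : Finset κ) => F k) : IsFinitePOVM F where
  nonneg k := h.nonneg ⟨k, Finset.mem_univ k⟩
  sum_eq_one := by rw [← h.sum_eq_one, Finset.sum_coe_sort Finset.univ F]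

end Derivative

/-! ### The chain of two maps -/

theorem mainTheorem8 {A₁ : Type v₁} {A₂ : Type v₂} {H : Type u}
    [CStarAlgebra A₁] [PartialOrder A₁] [StarOrderedRing A₁]
    [CStarAlgebra A₂] [PartialOrder A₂] [StarOrderedRing A₂]
    [NormedAddCommGroup H] [InnerProductSpace ℂ H] [CompleteSpace H]
    (R₁ : A₁ →CP (H →L[ℂ] H)) (R₂ : A₂ →CP A₁) (hR₁ : R₁ 1 = 1) (hR₂ : R₂ 1 = 1) :
    ∃ (K : Type (max u v₁ v₂)) (_ : NormedAddCommGroup K) (_ : InnerProductSpace ℂ K)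
      (_ : CompleteSpace K) (π : A₂ →⋆ₐ[ℂ] (K →L[ℂ] K)) (V : H →ₗᵢ[ℂ] K),
      -- dominated families, together with the finite decompositions that they contain
      (∀ (ι₁ : Type w₁) (ι₂ : Type w₂)
        (S₁ : ι₁ → (A₁ →CP (H →L[ℂ] H))) (S₂ : ι₂ → (A₂ →CP A₁)),
        (∀ x₁, CPDominated (S₁ x₁) R₁) → (∀ x₂, CPDominated (S₂ x₂) R₂) →
        ∃ (F₁ : ι₁ → (K →L[ℂ] K)) (F₂ : ι₂ → (K →L[ℂ] K)),
          IsChainDerivative S₁ S₂ π V F₁ F₂ ∧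
          (∀ s : Finset ι₁, (∀ a, ∑ x₁ ∈ s, S₁ x₁ a = R₁ a) →
            IsFinitePOVM (fun x₁ : s => F₁ x₁)) ∧
          (∀ s : Finset ι₂, (∀ a, ∑ x₂ ∈ s, S₂ x₂ a = R₂ a) →
            IsFinitePOVM (fun x₂ : s => F₂ x₂))) ∧
      -- finite decompositions of `R₁` and `R₂`
      (∀ (κ₁ : Type w₁) (κ₂ : Type w₂) [Fintype κ₁] [Fintype κ₂]
        (Q₁ : κ₁ → (A₁ →CP (H →L[ℂ] H))) (Q₂ : κ₂ → (A₂ →CP A₁)),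
        (∀ a, ∑ k₁, Q₁ k₁ a = R₁ a) → (∀ a, ∑ k₂, Q₂ k₂ a = R₂ a) →
        ∃ (F₁ : κ₁ → (K →L[ℂ] K)) (F₂ : κ₂ → (K →L[ℂ] K)),
          IsChainDerivative Q₁ Q₂ π V F₁ F₂ ∧ IsFinitePOVM F₁ ∧ IsFinitePOVM F₂) := by
  obtain ⟨K₁, _, _, _, ρ, V₁, h₁⟩ := R₁.exists_isMinimalDilation
  obtain ⟨K, _, _, _, π, V₂, h₂⟩ := (ρ.compCP R₂).exists_isMinimalDilation
  -- `V₂ V₁` is an isometry because both maps are unital.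
  have hV : adjoint (V₂ ∘L V₁) ∘L (V₂ ∘L V₁) = 1 := by
    have hV₁ : adjoint V₁ ∘L V₁ = 1 := by
      rw [← hR₁, h₁.isDilation 1, map_one]
      rfl
    have hV₂ : adjoint V₂ ∘L V₂ = 1 := by
      have := h₂.isDilation 1
      rw [StarAlgHom.compCP_apply, hR₂, map_one, map_one] at this
      exact this.symm
    rw [adjoint_comp, comp_assoc, ← comp_assoc _ V₂, hV₂]
    exact hV₁
  let V : H →ₗᵢ[ℂ] K := ⟨(V₂ ∘L V₁ : H →L[ℂ] K), (norm_map_iff_adjoint_comp_self _).mpr hV⟩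
  have hVeq : V.toContinuousLinearMap = V₂ ∘L V₁ := rfl
  have main (ι₁ : Type w₁) (ι₂ : Type w₂)
      (S₁ : ι₁ → (A₁ →CP (H →L[ℂ] H))) (S₂ : ι₂ → (A₂ →CP A₁))
      (hS₁ : ∀ x₁, CPDominated (S₁ x₁) R₁) (hS₂ : ∀ x₂, CPDominated (S₂ x₂) R₂) :
      ∃ (F₁ : ι₁ → (K →L[ℂ] K)) (F₂ : ι₂ → (K →L[ℂ] K)),
        IsChainDerivative S₁ S₂ π V F₁ F₂ ∧
        (∀ s : Finset ι₁, (∀ a, ∑ x₁ ∈ s, S₁ x₁ a = R₁ a) →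
          IsFinitePOVM (fun x₁ : s => F₁ x₁)) ∧
        (∀ s : Finset ι₂, (∀ a, ∑ x₂ ∈ s, S₂ x₂ a = R₂ a) →
          IsFinitePOVM (fun x₂ : s => F₂ x₂)) := by
    choose D hD using fun x₁ => h₁.exists_isRadonNikodym (hS₁ x₁)
    choose F₁ hF₁ hF₁V using fun x₁ =>
      h₂.exists_lift (hD x₁).nonneg (hD x₁).le_one fun a => (hD x₁).commute (R₂ a)
    choose F₂ hF₂ using fun x₂ => h₂.exists_isRadonNikodym ((hS₂ x₂).compCP ρ)
    -- Both products compress to `D x₁ ρ(S₂ x₂ a)`, since `D x₁` commutes with `ρ(A₁)`.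
    have comp₁₂ (x₁ : ι₁) (x₂ : ι₂) (a : A₂) :
        adjoint V₂ ∘L (F₁ x₁ * F₂ x₂ * π a) ∘L V₂ = D x₁ * ρ (S₂ x₂ a) :=
      (hF₂ x₂).lift_mul (hF₁ x₁).nonneg (hD x₁).nonneg (hF₁V x₁) a
    have comp₂₁ (x₁ : ι₁) (x₂ : ι₂) (a : A₂) :
        adjoint V₂ ∘L (F₂ x₂ * F₁ x₁ * π a) ∘L V₂ = ρ (S₂ x₂ a) * D x₁ :=
      (hF₂ x₂).mul_lift (hF₁ x₁).commute (hF₁V x₁) a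
    refine ⟨F₁, F₂, ?_, fun s hs => ?_, fun s hs => ?_⟩
    · refine
      { isSelfAdjoint₁ := fun x₁ => .of_nonneg (hF₁ x₁).nonneg
        isSelfAdjoint₂ := fun x₂ => .of_nonneg (hF₂ x₂).nonneg
        nonneg₁ := fun x₁ => (hF₁ x₁).nonneg
        nonneg₂ := fun x₂ => (hF₂ x₂).nonneg
        le_one₁ := fun x₁ => (hF₁ x₁).le_one
        le_one₂ := fun x₂ => (hF₂ x₂).le_one
        commute := fun x₁ x₂ => ?_
        commute_rep₁ := fun x₁ => (hF₁ x₁).commute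
        commute_rep₂ := fun x₂ => (hF₂ x₂).commute
        comp_eq := fun x₁ x₂ a => ?_ }
      · refine h₂.commutant_ext
          (fun a => ((hF₁ x₁).commute a).mul_left ((hF₂ x₂).commute a))
          (fun a => ((hF₂ x₂).commute a).mul_left ((hF₁ x₁).commute a)) fun a => ?_
        rw [comp₁₂, comp₂₁, ((hD x₁).commute _).eq]
      · rw [hVeq, adjoint_comp, ← (hD x₁).eq, ← comp₁₂]
        rfl
    · refine isFinitePOVM_subtype (fun x₁ => (hF₁ x₁).nonneg) (h₂.sum_eq_one hF₁ fun a => ?_)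
      rw [← Finset.mul_sum, h₁.sum_eq_one hD hs, mul_one]
    · refine isFinitePOVM_subtype (fun x₂ => (hF₂ x₂).nonneg) (h₂.sum_eq_one hF₂ fun a => ?_)
      simp only [StarAlgHom.compCP_apply, ← map_sum, hs]
  refine ⟨K, inferInstance, inferInstance, inferInstance, π, V, main, ?_⟩
  intro κ₁ κ₂ _ _ Q₁ Q₂ hQ₁ hQ₂
  obtain ⟨F₁, F₂, hF, hF₁, hF₂⟩ :=
    main κ₁ κ₂ Q₁ Q₂ (CPDominated.of_sum_eq hQ₁) (CPDominated.of_sum_eq hQ₂)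
  exact ⟨F₁, F₂, hF, (hF₁ _ hQ₁).of_univ, (hF₂ _ hQ₂).of_univ⟩
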